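/- Let $k$ be a field of characteristic zero, $D=k[d_1,\dots,d_n]=k[\chi_1,\dots,\chi_n]$ ($d_i\leftrightarrow\chi_i$) the ring of differential operators with constant coefficients, and let $\Phi$ be a system of linear PD equations with coefficients in $k$, of order at most $q$, in unknowns $y^1,\dots,y^m$, i.e. a set of elements of $Dy=Dy^1\oplus\cdots\oplus Dy^m\simeq D^m$. Let $M=Dy/D\Phi$ be the differential module it defines. Conventions. A jet $y^l_\mu=d_\mu y^l$ with $|\mu|\ge 1$ has order $|\mu|$ and class $\min\{i:\mu_i\neq0\}$; by convention $y^l$ itself has order $0$ and class $\infty$. The system $\Phi$ is called *involutive* of order $q$ (in the given coordinates) if the $k$-span of $\Phi$ has a finite basis $(\Psi_\tau)$ of elements of order $\le q$ in solved form (each $\Psi_\tau$ contains, with coefficient $1$, a principal jet, which occurs in no other $\Psi_\sigma$, and which has maximal order among the jets of $\Psi_\tau$ and maximal class among those of that order), such that every prolongation $d_i\Psi_\tau$ with respect to a nonmultiplicative derivation is a $k$-linear combination of the $\Psi_\sigma$ and of their prolongations with respect to multiplicative derivations. Here, for an equation of order $q$ whose principal jet has class $c$, the derivations $d_i$ with $i\le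 c$ are multiplicative and the other ones nonmultiplicative; for an equation of order $<q$ all of $d_1,\dots,d_n$ are nonmultiplicative. For a finitely generated $D$-module $N$, its codimension is $$cd_D(N)=\min_{\mathfrak p}\bigl(n-\operatorname{trdeg}_k Q(D/\mathfrak p)\bigr),$$ the minimum being over the minimal primes $\mathfrak p$ of $\operatorname{ann}_D(N)$, where $Q$ denotes the field of fractions and $cd_D(0)=\infty$. **Theorem 3.8.** Suppose that $\Phi$ is involutive of order $q$ and that $cd_D(M)=r$ with $r$ a natural number. Then $M$ has a largest submodule $t_r(M)$ of codimension $>r$ (possibly $0$), and the sequence $$0\longrightarrow t_r(M)\longrightarrow M\longrightarrow k(\chi_1,\dots,\chi_{n-r})\otimes_{k[\chi_1,\dots,\chi_{n-r}]}M ,$$ whose last map is $x\mapsto 1\otimes x$, is exact. -/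

import Mathlib

open scoped TensorProduct

noncomputable section

/-- The ring `D = k[d_1, …, d_n]` of differential operators with constant coefficients in `k`.
The derivations `d_1, …, d_n` are `X 0, …, X (n - 1)`. -/
abbrev DiffOp (k : Type*) [Field k] (n : ℕ) : Type _ := MvPolynomial (Fin n) k

/-- The jets `y^l_μ` of `m` unknowns, with `μ` a multi-index in `n` variables. -/
abbrev Jet (m n : ℕ) : Type := Fin m × (Fin n →₀ ℕ)

/-- The order `|μ|` of the jet `y^l_μ`. -/
def jetOrder {m n : ℕ} (J : Jet m n) : ℕ := J.2.degree

/-- The class of the jet `y^l_μ`: the least `i` with `μ_i ≠ 0` (and `⊤` for `μ = 0`). -/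
def jetClass {m n : ℕ} (J : Jet m n) : WithTop (Fin n) := J.2.support.min

/-- The coefficient of the jet `y^l_μ` in the linear PD equation `∑_l P_l y^l = 0`, which is
recorded as the row `P = (P_1, …, P_m)` of operators. -/
def jetCoeff {k : Type*} [Field k] {m n : ℕ} (P : Fin m → DiffOp k n) (J : Jet m n) : k :=
  (P J.1).coeff J.2

/-- The equations `Ψ_τ = 0` form a system of order (at most) `q` in solved form, `Ψ_τ` being solved
with respect to its principal jet `pri τ`: this jet has coefficient `1` in `Ψ_τ`, it occurs in no
other equation, it has the maximal order among the jets of `Ψ_τ`, and the maximal class among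
the jets of `Ψ_τ` of this order. -/
structure IsSolvedForm {k : Type*} [Field k] {m n : ℕ} (q : ℕ) {ι : Type}
    (Ψ : ι → Fin m → DiffOp k n) (pri : ι → Jet m n) : Prop where
  order_le : ∀ τ, jetOrder (pri τ) ≤ q
  coeff_self : ∀ τ, jetCoeff (Ψ τ) (pri τ) = 1
  coeff_other : ∀ τ σ, σ ≠ τ → jetCoeff (Ψ τ) (pri σ) = 0
  order_max : ∀ τ J, jetCoeff (Ψ τ) J ≠ 0 → jetOrder J ≤ jetOrder (pri τ)
  class_max : ∀ τ J, jetCoeff (Ψ τ) J ≠ 0 → jetOrder J = jetOrder (pri τ) →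
    jetClass J ≤ jetClass (pri τ)

/-- In a system of order `q`, the derivation `d_i` is multiplicative for an equation with principal
jet `J` if the equation has order `q` and `i` is at most its class.  No derivation is
multiplicative for an equation of order less than `q`. -/
def IsMultiplicative {m n : ℕ} (q : ℕ) (J : Jet m n) (i : Fin n) : Prop :=
  jetOrder J = q ∧ (i : WithTop (Fin n)) ≤ jetClass J

/-- The system of PD equations `Φ` is involutive of order `q` (in the given coordinates): its
equations can be brought by linear combinations over `k` to a solved form of order `q` in which
every prolongation `d_i Ψ_τ` with respect to a nonmultiplicative derivation is a linear
combination over `k` of the equations `Ψ_σ` and of their prolongations `d_j Ψ_σ` with respect to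
multiplicative derivations. -/
def IsInvolutive {k : Type*} [Field k] {m n : ℕ} (q : ℕ) (Φ : Set (Fin m → DiffOp k n)) : Prop :=
  ∃ (p : ℕ) (Ψ : Fin p → Fin m → DiffOp k n) (pri : Fin p → Jet m n),
    IsSolvedForm q Ψ pri ∧
    Submodule.span k (Set.range Ψ) = Submodule.span k Φ ∧
    ∀ (τ : Fin p) (i : Fin n), ¬ IsMultiplicative q (pri τ) i →
      (MvPolynomial.X i : DiffOp k n) • Ψ τ ∈
        Submodule.span k (Set.range Ψ ∪
          {P | ∃ (σ : Fin p) (j : Fin n), IsMultiplicative q (pri σ) j ∧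
            P = (MvPolynomial.X j : DiffOp k n) • Ψ σ})

/-- The differential module `M = Dy / DΦ` defined by the system `Φ`. -/
abbrev DiffModule {k : Type*} [Field k] {m n : ℕ} (Φ : Set (Fin m → DiffOp k n)) : Type _ :=
  (Fin m → DiffOp k n) ⧸ Submodule.span (DiffOp k n) Φ

/-- The codimension `cd(D/𝔭) = n - trd(Q(D/𝔭)/k)` of a prime ideal. -/
def primeCodim {k : Type*} [Field k] {n : ℕ} (P : Ideal (DiffOp k n)) : ℕ :=
  n - Cardinal.toNat (Algebra.trdeg k (FractionRing (DiffOp k n ⧸ P)))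

/-- The codimension `cd_D(M)` of a (finitely generated) `D`-module: the minimum of the codimensions
of the minimal primes of its annihilator.  It is `⊤` for the zero module. -/
def moduleCodim (k : Type*) [Field k] (n : ℕ) (M : Type*) [AddCommGroup M]
    [Module (DiffOp k n) M] : ℕ∞ :=
  ⨅ P ∈ (Module.annihilator (DiffOp k n) M).minimalPrimes, (primeCodim P : ℕ∞)

/-- `t_r(M)`, the largest submodule of `M` of codimension greater than `r`, as the supremum of all
such submodules. -/
def torsionSub (k : Type*) [Field k] (n r : ℕ) (M : Type*) [AddCommGroup M]
    [Module (DiffOp k n) M] : Submodule (DiffOp k n) M :=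
  sSup {N : Submodule (DiffOp k n) M | (r : ℕ∞) < moduleCodim k n N}

/-- The subring `k[χ_1, …, χ_s]` of `D = k[χ_1, …, χ_n]` generated by the first `s`
indeterminates. -/
abbrev firstVars (k : Type*) [Field k] (n s : ℕ) : Subalgebra k (DiffOp k n) :=
  MvPolynomial.supported k {i : Fin n | (i : ℕ) < s}

/-- For a module `M` over a domain `R`, the localization `Q(R) ⊗_R M` at the nonzero elements
of `R`. -/
abbrev GenericLoc (R : Type*) [CommRing R] (M : Type*) [AddCommGroup M] [Module R M] : Type _ :=
  FractionRing R ⊗[R] M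

/-- The canonical map `M → Q(R) ⊗_R M`, `x ↦ 1 ⊗ x`. -/
def genericLocMap (R : Type*) [CommRing R] (M : Type*) [AddCommGroup M] [Module R M] :
    M →ₗ[R] GenericLoc R M :=
  TensorProduct.mk R (FractionRing R) M 1

/-- The partial localization `M → k(χ_1, …, χ_s) ⊗ M`, `x ↦ 1 ⊗ x`, where the tensor product is
over `k[χ_1, …, χ_s]`. -/
def partialLoc (k : Type*) [Field k] (n s : ℕ) (M : Type*) [AddCommGroup M]
    [Module (DiffOp k n) M] : M → GenericLoc (firstVars k n s) M :=
  genericLocMap (firstVars k n s) M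

end

/-! Put `s = n - r` and `A = k[χ_1, …, χ_s]`. Everything rests on `M` being finite over `A`. Then
`D/P` is integral over `A` for every prime `P` containing `ann M`, so a submodule killed by one
nonzero element of `A` has codimension greater than `r`. Conversely, codimension greater than `r`
forces the annihilator to meet `A` nontrivially, by a dimension count alone
(`exists_mem_firstVars_annihilator`). Hence `t_r(M)` is the `A`-torsion of `M`
(`isGreatest_firstVarsTorsion`), which is the kernel of the localization.

Finiteness is where involution enters. The multiplicative prolongations span `DΦ` over `k`
(`mem_span_multProlong_of_mem_span`), and their leading jets do not cancel
(`jetCoeff_linearCombination_of_max`). So no nonzero operator in the variables up to its class kills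
a parametric jet of order `q` in `M` (`eq_zero_of_smul_jetVec_mem`). For `r > 0`, since `cd M > r -
1`, some nonzero element of `k[χ_1, …, χ_{s+1}]` kills `M`; hence all jets of order `q` and class at
least `s + 1` are principal, and they reduce to jets of lower order or lower class
(`finite_firstVars_quotient`). -/

/-! ### Codimension and torsion over the first variables -/

theorem trdeg_fractionRing_eq {k A : Type*} [Field k] [CommRing A] [IsDomain A] [Algebra k A] :
    Algebra.trdeg k (FractionRing A) = Algebra.trdeg k A := by
  have := IsLocalization.isAlgebraic (FractionRing A) (nonZeroDivisors A)
  rw [← trdeg_add_eq k A (A := FractionRing A), trdeg_eq_zero (R := A), add_zero]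

theorem primeCodim_eq {k : Type*} [Field k] {n : ℕ} (P : Ideal (DiffOp k n)) [P.IsPrime] :
    primeCodim P = n - Cardinal.toNat (Algebra.trdeg k (DiffOp k n ⧸ P)) := by
  rw [primeCodim, trdeg_fractionRing_eq]

theorem card_fin_val_lt {n s : ℕ} (h : s ≤ n) : Fintype.card {i : Fin n // (i : ℕ) < s} = s := by
  rw [Fintype.card_subtype]
  have := Fin.card_filter_val_lt (n := n) (m := s)
  simpa [h] using this

/-- If a prime meets `k[χ_1, …, χ_s]` trivially, its quotient has dimension at least `s`. -/
theorem le_trdeg_quotient {k : Type*} [Field k] {n s : ℕ} (hs : s ≤ n) (P : Ideal (DiffOp k n))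
    [P.IsPrime] (h : ∀ f ∈ firstVars k n s, f ∈ P → f = 0) :
    s ≤ Cardinal.toNat (Algebra.trdeg k (DiffOp k n ⧸ P)) := by
  have hind : AlgebraicIndependent k
      (fun i : {i : Fin n // (i : ℕ) < s} => Ideal.Quotient.mkₐ k P (MvPolynomial.X i.1)) := by
    rw [algebraicIndependent_iff]
    intro p hp
    have h1 : Ideal.Quotient.mkₐ k P (MvPolynomial.rename Subtype.val p) = 0 := by
      rw [← hp, MvPolynomial.rename_eq_aeval, ← MvPolynomial.comp_aeval_apply]
      rfl
    have h2 := h (MvPolynomial.rename Subtype.val p) (by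
      have := MvPolynomial.supported_eq_range_rename (R := k) {i : Fin n | (i : ℕ) < s}
      rw [firstVars, this]
      exact ⟨p, rfl⟩) (Ideal.Quotient.eq_zero_iff_mem.mp h1)
    exact MvPolynomial.rename_injective _ Subtype.val_injective (by rw [h2, map_zero])
  have hle := hind.lift_cardinalMk_le_trdeg
  have hfin := trdeg_lt_aleph0_of_finiteType (R := k) (S := DiffOp k n ⧸ P)
  have := Cardinal.toNat_le_toNat hle (by simpa using hfin)
  simpa [card_fin_val_lt hs] using this

/-- A module of codimension greater than `r` is killed by a nonzero element of
`k[χ_1, …, χ_{n-r}]`. -/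
theorem exists_mem_firstVars_annihilator {k : Type*} [Field k] {n r : ℕ} {N : Type*}
    [AddCommGroup N] [Module (DiffOp k n) N] (h : (r : ℕ∞) < moduleCodim k n N) :
    ∃ f ∈ firstVars k n (n - r), f ≠ 0 ∧ f ∈ Module.annihilator (DiffOp k n) N := by
  by_contra! hcon
  let S : Submonoid (DiffOp k n) :=
    (firstVars k n (n - r)).toSubmonoid ⊓ nonZeroDivisors (DiffOp k n)
  have hdis : Disjoint (Module.annihilator (DiffOp k n) N : Set (DiffOp k n)) S := by
    rw [Set.disjoint_left]
    rintro f hf ⟨h1, h2⟩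
    exact hcon f h1 (nonZeroDivisors.ne_zero h2) hf
  -- A minimal prime inside `Q` also meets `k[χ_1, …, χ_{n-r}]` only in zero, so its codimension is
  -- at most `r`.
  obtain ⟨Q, hQ, hle, hQd⟩ := Ideal.exists_le_prime_disjoint _ S hdis
  obtain ⟨P, hP, hPQ⟩ := Ideal.exists_minimalPrimes_le hle
  have : P.IsPrime := hP.1.1
  have h1 : n - r ≤ _ := le_trdeg_quotient (Nat.sub_le n r) P (fun f hf hfP => by
    by_contra hne
    exact Set.disjoint_left.mp hQd (hPQ hfP) ⟨hf, mem_nonZeroDivisors_of_ne_zero hne⟩)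
  have h2 : (r : ℕ∞) < primeCodim P := h.trans_le (iInf₂_le P hP)
  rw [primeCodim_eq] at h2
  have h3 := Nat.cast_lt.mp h2
  omega

/-- If `D / P` is integral over `k[χ_1, …, χ_s]` and `P` contains a nonzero element of that ring,
then `D / P` has dimension less than `s`. -/
theorem trdeg_quotient_lt {k : Type*} [Field k] {n s : ℕ} (hs : s ≤ n) (P : Ideal (DiffOp k n))
    [P.IsPrime] (hint : ∀ y : DiffOp k n ⧸ P, IsIntegral (firstVars k n s) y)
    {f : DiffOp k n} (hf : f ∈ firstVars k n s) (hf0 : f ≠ 0) (hfP : f ∈ P) :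
    Cardinal.toNat (Algebra.trdeg k (DiffOp k n ⧸ P)) < s := by
  let x : {i : Fin n // (i : ℕ) < s} → DiffOp k n ⧸ P :=
    fun i => Ideal.Quotient.mkₐ k P (MvPolynomial.X i.1)
  have hadj : Algebra.adjoin k (Set.range x) = (firstVars k n s).map (Ideal.Quotient.mkₐ k P) := by
    rw [firstVars, MvPolynomial.supported_eq_adjoin_X, AlgHom.map_adjoin]
    congr 1
    ext z
    simp [x]
  have halg : Algebra.IsAlgebraic (Algebra.adjoin k (Set.range x)) (DiffOp k n ⧸ P) := by
    rw [hadj]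
    refine ⟨fun y => IsIntegral.isAlgebraic ?_⟩
    let φ : firstVars k n s →+* (firstVars k n s).map (Ideal.Quotient.mkₐ k P) :=
      (((Ideal.Quotient.mkₐ k P).comp (firstVars k n s).val).codRestrict _
        (fun a => Subalgebra.mem_map.mpr ⟨a.1, a.2, rfl⟩)).toRingHom
    exact IsIntegral.map_of_comp_eq φ (RingHom.id _) (by ext; rfl) (hint y)
  by_contra! hle
  have hfin := trdeg_lt_aleph0_of_finiteType (R := k) (S := DiffOp k n ⧸ P)
  -- If the transcendence degree were at least `s`, the `s` images of the variables would form a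
  -- transcendence basis; but `f` is an algebraic relation between them.
  have hb := Algebra.IsAlgebraic.isTranscendenceBasis_of_lift_le_trdeg_of_finite (R := k) x (by
    rw [← Cardinal.cast_toNat_of_lt_aleph0 hfin]
    simpa [card_fin_val_lt hs] using hle)
  have hind := hb.1
  rw [algebraicIndependent_iff] at hind
  rw [firstVars, MvPolynomial.supported_eq_range_rename] at hf
  obtain ⟨p, rfl⟩ := hf
  apply hf0
  have : MvPolynomial.aeval x p = 0 := by
    have h1 := Ideal.Quotient.eq_zero_iff_mem.mpr hfP
    change Ideal.Quotient.mkₐ k P (MvPolynomial.rename Subtype.val p) = 0 at h1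
    rw [← h1, MvPolynomial.rename_eq_aeval, ← MvPolynomial.comp_aeval_apply]
    rfl
  change MvPolynomial.rename Subtype.val p = 0
  rw [hind p this, map_zero]

/-- Cayley–Hamilton: `y` acts on a finite module, so a monic polynomial in `y` kills `M` and
therefore lies in `P`. -/
theorem isIntegral_quotient_of_annihilator_le {k : Type*} [Field k] {n s : ℕ} {M : Type*}
    [AddCommGroup M] [Module (DiffOp k n) M] [Module.Finite (firstVars k n s) M]
    {P : Ideal (DiffOp k n)} (hP : Module.annihilator (DiffOp k n) M ≤ P)
    (y : DiffOp k n ⧸ P) : IsIntegral (firstVars k n s) y := by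
  obtain ⟨y, rfl⟩ := Ideal.Quotient.mk_surjective y
  obtain ⟨p, hp, hp0⟩ := Algebra.IsIntegral.isIntegral (R := firstVars k n s)
    (Algebra.lsmul (firstVars k n s) (firstVars k n s) M y)
  refine ⟨p, hp, ?_⟩
  change Polynomial.aeval _ p = 0 at hp0
  rw [Polynomial.aeval_algHom_apply] at hp0
  have hmem : Polynomial.aeval y p ∈ P := hP (Module.mem_annihilator.mpr fun m => by
    simpa using LinearMap.congr_fun hp0 m)
  change Polynomial.aeval (Ideal.Quotient.mkₐ (firstVars k n s) P y) p = 0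
  rw [Polynomial.aeval_algHom_apply]
  exact Ideal.Quotient.eq_zero_iff_mem.mpr hmem

theorem genericLocMap_eq_zero_iff {R M : Type*} [CommRing R] [IsDomain R] [AddCommGroup M]
    [Module R M] (x : M) : genericLocMap R M x = 0 ↔ ∃ s : R, s ≠ 0 ∧ s • x = 0 := by
  have : IsLocalizedModule (nonZeroDivisors R) (genericLocMap R M) :=
    (isLocalizedModule_iff_isBaseChange (nonZeroDivisors R) (FractionRing R) _).mpr
      (TensorProduct.isBaseChange R M (FractionRing R))
  rw [IsLocalizedModule.eq_zero_iff (nonZeroDivisors R)]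
  constructor
  · rintro ⟨s, hs⟩
    exact ⟨s, nonZeroDivisors.ne_zero s.2, hs⟩
  · rintro ⟨s, h0, hs⟩
    exact ⟨⟨s, mem_nonZeroDivisors_of_ne_zero h0⟩, hs⟩

theorem partialLoc_eq_zero_iff {k : Type*} [Field k] {n s : ℕ} {M : Type*} [AddCommGroup M]
    [Module (DiffOp k n) M] (x : M) :
    partialLoc k n s M x = 0 ↔ ∃ f ∈ firstVars k n s, f ≠ 0 ∧ f • x = 0 := by
  rw [partialLoc, genericLocMap_eq_zero_iff]
  constructor
  · rintro ⟨f, h0, hf⟩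
    exact ⟨f, f.2, by simpa using h0, hf⟩
  · rintro ⟨f, hf, h0, hx⟩
    exact ⟨⟨f, hf⟩, fun h => h0 (congrArg Subtype.val h), hx⟩

/-- The `D`-submodule of the elements of `M` killed by a nonzero element of `k[χ_1, …, χ_s]`. -/
def firstVarsTorsion (k : Type*) [Field k] (n s : ℕ) (M : Type*) [AddCommGroup M]
    [Module (DiffOp k n) M] : Submodule (DiffOp k n) M where
  carrier := {x | ∃ f ∈ firstVars k n s, f ≠ 0 ∧ f • x = 0}
  zero_mem' := ⟨1, one_mem _, one_ne_zero, smul_zero _⟩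
  add_mem' := by
    rintro x y ⟨f, hf, f0, hx⟩ ⟨g, hg, g0, hy⟩
    refine ⟨f * g, mul_mem hf hg, mul_ne_zero f0 g0, ?_⟩
    rw [smul_add, mul_smul f g y, hy, mul_comm, mul_smul, hx]
    simp
  smul_mem' := by
    rintro c x ⟨f, hf, f0, hx⟩
    exact ⟨f, hf, f0, by rw [smul_comm, hx, smul_zero]⟩

/-- The torsion is finitely generated because `D` is Noetherian, so the product of annihilators of
generators kills all of it at once. -/
theorem exists_mem_firstVars_annihilator_torsion {k : Type*} [Field k] {n s : ℕ} {M : Type*}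
    [AddCommGroup M] [Module (DiffOp k n) M] [Module.Finite (DiffOp k n) M] :
    ∃ f ∈ firstVars k n s, f ≠ 0 ∧
      f ∈ Module.annihilator (DiffOp k n) (firstVarsTorsion k n s M) := by
  obtain ⟨S, hS⟩ := (inferInstance : IsNoetherian (DiffOp k n) M).noetherian
    (firstVarsTorsion k n s M)
  have hmem : ∀ x ∈ S, x ∈ firstVarsTorsion k n s M := fun x hx => by
    rw [← hS]; exact Submodule.subset_span hx
  have hmem' : ∀ x : M, ∃ f : DiffOp k n, f ∈ firstVars k n s ∧ f ≠ 0 ∧ (x ∈ S → f • x = 0) := by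
    intro x
    by_cases hx : x ∈ S
    · obtain ⟨f, h1, h2, h3⟩ := hmem x hx
      exact ⟨f, h1, h2, fun _ => h3⟩
    · exact ⟨1, one_mem _, one_ne_zero, fun h => absurd h hx⟩
  choose f hf f0 hfx using hmem'
  refine ⟨∏ x ∈ S, f x, prod_mem fun x _ => hf x, Finset.prod_ne_zero_iff.mpr fun x _ => f0 x, ?_⟩
  rw [Submodule.mem_annihilator]
  intro y hy
  rw [← hS] at hy
  induction hy using Submodule.span_induction with
  | mem x hx =>
    classical
    rw [← Finset.prod_erase_mul S f hx, mul_smul, hfx x hx, smul_zero]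
  | zero => exact smul_zero _
  | add x y _ _ hx hy => rw [smul_add, hx, hy, add_zero]
  | smul c x _ hx => rw [smul_comm, hx, smul_zero]

/-- For a module that is finite over `k[χ_1, …, χ_{n-r}]`, the torsion over this ring is the
largest submodule of codimension greater than `r`. -/
theorem isGreatest_firstVarsTorsion {k : Type*} [Field k] {n r : ℕ} {M : Type*}
    [AddCommGroup M] [Module (DiffOp k n) M] [Module.Finite (firstVars k n (n - r)) M] :
    IsGreatest {N : Submodule (DiffOp k n) M | (r : ℕ∞) < moduleCodim k n N}
      (firstVarsTorsion k n (n - r) M) := by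
  have : Module.Finite (DiffOp k n) M :=
    Module.Finite.of_restrictScalars_finite (firstVars k n (n - r)) _ _
  constructor
  · obtain ⟨f, hf, f0, hann⟩ :=
      exists_mem_firstVars_annihilator_torsion (k := k) (n := n) (s := n - r) (M := M)
    -- A strict bound need not survive an infimum, so each prime is compared with `r + 1`.
    refine lt_of_lt_of_le (b := ((r + 1 : ℕ) : ℕ∞)) (by exact_mod_cast Nat.lt_succ_self r) ?_
    refine le_iInf₂ fun P hP => ?_
    have : P.IsPrime := hP.1.1
    have hle : Module.annihilator (DiffOp k n) M ≤ P :=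
      ((firstVarsTorsion k n (n - r) M).subtype.annihilator_le_of_injective
        (Submodule.subtype_injective _)).trans hP.1.2
    have := trdeg_quotient_lt (Nat.sub_le n r) P (isIntegral_quotient_of_annihilator_le hle) hf f0
      (hP.1.2 hann)
    rw [primeCodim_eq]
    exact_mod_cast (by omega)
  · intro N hN x hx
    obtain ⟨f, hf, f0, hann⟩ := exists_mem_firstVars_annihilator hN
    exact ⟨f, hf, f0, (Submodule.mem_annihilator.mp hann) x hx⟩

/-! ### Weights of multi-indices -/

section Weight

variable {n : ℕ}

/-- The weight `∑ i, i * μ_i` of a multi-index `μ`. -/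
def multiIndexWeight (μ : Fin n →₀ ℕ) : ℕ := ∑ i : Fin n, (i : ℕ) * μ i

/-- Among the decompositions of a multi-index into two summands of given orders, the one in which
the indices of the first summand are at most those of the second has least weight of the first
summand, and is the only one with this weight. -/
theorem multiIndexWeight_le_of_add_eq {μ μ' ν ν' : Fin n →₀ ℕ} (h : ν + μ = ν' + μ')
    (hdeg : μ.degree = μ'.degree) (hle : ∀ i ∈ μ.support, ∀ j ∈ ν.support, i ≤ j) :
    multiIndexWeight μ ≤ multiIndexWeight μ' ∧
      (multiIndexWeight μ = multiIndexWeight μ' → μ = μ') := by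
  -- The threshold `b` separates the two summands: `μ` lives on indices at most `b`, `ν` on indices
  -- at least `b`.
  obtain ⟨b, hb1, hb2⟩ : ∃ b : ℕ, (∀ i : Fin n, b < i → μ i = 0) ∧
      (∀ i : Fin n, (i : ℕ) < b → ν i = 0) := by
    refine ⟨μ.support.sup Fin.val, fun i hi => ?_, fun i hi => ?_⟩
    · by_contra hne
      exact absurd (Finset.le_sup (f := Fin.val) (Finsupp.mem_support_iff.mpr hne)) (by omega)
    · by_contra hne
      obtain ⟨j, hj, hij⟩ := (Finset.lt_sup_iff).mp hi
      have := hle j hj i (Finsupp.mem_support_iff.mpr hne)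
      have := Fin.le_def.mp this
      omega
  have hi : ∀ i, ν i + μ i = ν' i + μ' i := fun i => DFunLike.congr_fun h i
  rw [Finsupp.degree_eq_sum, Finsupp.degree_eq_sum] at hdeg
  -- Below `b` all of the sum belongs to `μ`, above `b` none of it does. Since the orders agree,
  -- replacing the weight factor `i` by `i - b` does not change the difference of weights.
  have hnn : ∀ i : Fin n, 0 ≤ ((i : ℤ) - b) * ((μ' i : ℤ) - μ i) := by
    intro i
    have := hi i
    rcases lt_trichotomy (i : ℕ) b with h1 | h1 | h1
    · have := hb2 i h1
      exact mul_nonneg_of_nonpos_of_nonpos (by omega) (by omega)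
    · simp [h1]
    · have := hb1 i h1
      exact mul_nonneg (by omega) (by omega)
  have hsum : (multiIndexWeight μ' : ℤ) - multiIndexWeight μ =
      ∑ i : Fin n, ((i : ℤ) - b) * ((μ' i : ℤ) - μ i) := by
    have hz : (∑ i : Fin n, (μ i : ℤ)) = ∑ i, (μ' i : ℤ) := by exact_mod_cast hdeg
    simp only [multiIndexWeight, sub_mul, mul_sub, Finset.sum_sub_distrib, ← Finset.mul_sum, hz]
    push_cast
    ring
  refine ⟨by have := Finset.sum_nonneg fun i (_ : i ∈ Finset.univ) => hnn i; omega, fun heq => ?_⟩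
  rw [heq, sub_self] at hsum
  have hzero := (Finset.sum_eq_zero_iff_of_nonneg fun i _ => hnn i).mp hsum.symm
  have hne : ∀ i : Fin n, (i : ℕ) ≠ b → μ i = μ' i := by
    intro i hib
    rcases mul_eq_zero.mp (hzero i (Finset.mem_univ i)) with h1 | h1 <;> omega
  ext i
  by_cases hib : (i : ℕ) = b
  · rw [← Finset.add_sum_erase _ _ (Finset.mem_univ i),
      ← Finset.add_sum_erase _ (fun i => μ' i) (Finset.mem_univ i)] at hdeg
    have : ∑ j ∈ Finset.univ.erase i, μ j = ∑ j ∈ Finset.univ.erase i, μ' j :=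
      Finset.sum_congr rfl fun j hj => hne j fun h =>
        (Finset.mem_erase.mp hj).1 (Fin.ext (h.trans hib.symm))
    omega
  · exact hne i hib

theorem eq_single_of_mem_support {μ : Fin n →₀ ℕ} (h : μ.degree ≤ 1) {i : Fin n}
    (hi : i ∈ μ.support) : μ = Finsupp.single i 1 := by
  have hle : Finsupp.single i 1 ≤ μ := by simpa [Nat.one_le_iff_ne_zero] using hi
  obtain ⟨ν, rfl⟩ := exists_add_of_le hle
  simp only [map_add, Finsupp.degree_single] at h
  rw [(Finsupp.degree_eq_zero_iff ν).mp (by omega), add_zero]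

end Weight

/-! ### Leading jets of multiplicative prolongations -/

section Jets

variable {k : Type*} [Field k] {m n : ℕ}

/-- The coefficient of a jet, as a linear form. -/
noncomputable def jetCoeffLin (k : Type*) [Field k] {m n : ℕ} (J : Jet m n) :
    (Fin m → DiffOp k n) →ₗ[k] k :=
  MvPolynomial.lcoeff k J.2 ∘ₗ LinearMap.proj J.1

@[simp] theorem jetCoeffLin_apply (J : Jet m n) (P : Fin m → DiffOp k n) :
    jetCoeffLin k J P = jetCoeff P J := rfl

theorem jetCoeff_monomial_smul (μ : Fin n →₀ ℕ) (P : Fin m → DiffOp k n) (J : Jet m n) :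
    jetCoeff (MvPolynomial.monomial μ (1 : k) • P) J =
      if μ ≤ J.2 then jetCoeff P (J.1, J.2 - μ) else 0 := by
  simp [jetCoeff, MvPolynomial.coeff_monomial_mul']

theorem jetCoeff_monomial_smul_add (μ : Fin n →₀ ℕ) (P : Fin m → DiffOp k n) (J : Jet m n) :
    jetCoeff (MvPolynomial.monomial μ (1 : k) • P) (J.1, J.2 + μ) = jetCoeff P J := by
  simp [jetCoeff_monomial_smul]

theorem exists_of_jetCoeff_monomial_smul_ne_zero {μ : Fin n →₀ ℕ} {P : Fin m → DiffOp k n}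
    {J : Jet m n} (h : jetCoeff (MvPolynomial.monomial μ (1 : k) • P) J ≠ 0) :
    ∃ ν, J.2 = ν + μ ∧ jetCoeff P (J.1, ν) ≠ 0 := by
  rw [jetCoeff_monomial_smul] at h
  split_ifs at h with hle
  · exact ⟨J.2 - μ, (tsub_add_cancel_of_le hle).symm, h⟩
  · exact absurd rfl h

/-- The jet `J`, as an element of `Dy`. -/
noncomputable def jetVec (k : Type*) [Field k] {m n : ℕ} (J : Jet m n) : Fin m → DiffOp k n :=
  Pi.single J.1 (MvPolynomial.monomial J.2 1)

theorem jetCoeff_jetVec (J K : Jet m n) :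
    jetCoeff (jetVec k J) K = if K = J then 1 else 0 := by
  obtain ⟨l, μ⟩ := J
  obtain ⟨l', μ'⟩ := K
  by_cases hl : l' = l
  · subst hl
    simp [jetCoeff, jetVec, MvPolynomial.coeff_monomial, eq_comm]
  · simp [jetCoeff, jetVec, hl]

theorem monomial_smul_jetVec (μ : Fin n →₀ ℕ) (J : Jet m n) :
    MvPolynomial.monomial μ (1 : k) • jetVec k J = jetVec k (J.1, J.2 + μ) := by
  simp [jetVec, ← Pi.single_smul, MvPolynomial.monomial_mul, add_comm]

theorem isMultiplicative_iff {q : ℕ} {J : Jet m n} {i : Fin n} :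
    IsMultiplicative q J i ↔ jetOrder J = q ∧ ∀ j ∈ J.2.support, i ≤ j := by
  simp only [IsMultiplicative, jetClass, Finset.le_min_iff, WithTop.coe_le_coe]

variable {ι : Type} {q : ℕ}

/-- The prolongation `d_μ Ψ_τ`. -/
noncomputable def prolong (Ψ : ι → Fin m → DiffOp k n) (x : ι × (Fin n →₀ ℕ)) :
    Fin m → DiffOp k n :=
  MvPolynomial.monomial x.2 (1 : k) • Ψ x.1

/-- The prolongations `d_μ Ψ_τ` with respect to multiplicative derivations among the first `c`
ones. -/
def multProlong (q : ℕ) (pri : ι → Jet m n) (c : ℕ) : Set (ι × (Fin n →₀ ℕ)) :=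
  {x | ∀ i ∈ x.2.support, (i : ℕ) < c ∧ IsMultiplicative q (pri x.1) i}

theorem multProlong_mono {pri : ι → Jet m n} {c d : ℕ} (h : c ≤ d) :
    multProlong q pri c ⊆ multProlong q pri d :=
  fun _ hx i hi => ⟨(hx i hi).1.trans_le h, (hx i hi).2⟩

/-- A multiplicative prolongation of a principal jet of order `q` which has maximal order and
weight among those in a linear combination does not cancel. -/
theorem jetCoeff_linearCombination_of_max {Ψ : ι → Fin m → DiffOp k n} {pri : ι → Jet m n}
    (hΨ : IsSolvedForm q Ψ pri) {c : ℕ} {a : ι × (Fin n →₀ ℕ) →₀ k}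
    (ha : a ∈ Finsupp.supported k k (multProlong q pri c)) {τ : ι} {μ : Fin n →₀ ℕ}
    (hτ : (τ, μ) ∈ a.support) (hq : jetOrder (pri τ) = q)
    (hmax : ∀ x ∈ a.support, jetOrder (pri x.1) = q → x.2.degree ≤ μ.degree ∧
      (x.2.degree = μ.degree → multiIndexWeight x.2 ≤ multiIndexWeight μ)) :
    jetCoeff (Finsupp.linearCombination k (prolong Ψ) a) ((pri τ).1, (pri τ).2 + μ) = a (τ, μ) := by
  rw [← jetCoeffLin_apply, Finsupp.linearCombination_apply, Finsupp.sum, map_sum,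
    Finset.sum_eq_single_of_mem (τ, μ) hτ]
  · rw [map_smul, jetCoeffLin_apply, prolong, jetCoeff_monomial_smul_add, hΨ.coeff_self]
    simp
  rintro ⟨σ, ν⟩ hσ hne
  rw [map_smul, jetCoeffLin_apply]
  by_contra hcon
  obtain ⟨ρ, hρ, hcoeff⟩ := exists_of_jetCoeff_monomial_smul_ne_zero (right_ne_zero_of_mul hcon)
  dsimp only at hρ hcoeff
  have hdeg := congrArg Finsupp.degree hρ
  rw [map_add, map_add] at hdeg
  have hord : ρ.degree ≤ jetOrder (pri σ) := hΨ.order_max σ _ hcoeff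
  have hσq := hΨ.order_le σ
  have hτdeg : (pri τ).2.degree = q := hq
  have hνdeg : ν.degree ≤ μ.degree := by
    by_cases h : jetOrder (pri σ) = q
    · exact (hmax _ hσ h).1
    · have : ν = 0 := by
        rw [← Finsupp.support_eq_empty, Finset.eq_empty_iff_forall_notMem]
        exact fun i hi => h ((ha hσ) i hi).2.1
      simp [this]
  -- If the jet also occurs in another term, both factors of that term must have the same orders as
  -- here.
  have hσeq : jetOrder (pri σ) = q := by omega
  have hνμ : ν.degree = μ.degree := by omega
  -- Multiplicativity makes the weight of `μ` least among such decompositions, while its choice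
  -- makes it greatest among the terms; hence `ν = μ`, and `pri τ` would occur in `Ψ σ`.
  have hw := multiIndexWeight_le_of_add_eq hρ hνμ.symm
    fun i hi => (isMultiplicative_iff.mp ((ha hτ) i hi).2).2
  have hw' := (hmax _ hσ hσeq).2 hνμ
  obtain rfl := hw.2 (le_antisymm hw.1 hw')
  obtain rfl := add_right_cancel hρ
  have hστ : τ ≠ σ := by
    rintro rfl
    exact hne rfl
  exact hcoeff (hΨ.coeff_other σ τ hστ)

/-- A linear combination of multiplicative prolongations either involves only equations of
order less than `q`, or it has a term as in `jetCoeff_linearCombination_of_max`. -/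
theorem exists_max_of_mem_support {pri : ι → Jet m n} {a : ι × (Fin n →₀ ℕ) →₀ k}
    (h : ∃ x ∈ a.support, jetOrder (pri x.1) = q) :
    ∃ τ μ, (τ, μ) ∈ a.support ∧ jetOrder (pri τ) = q ∧
      ∀ x ∈ a.support, jetOrder (pri x.1) = q → x.2.degree ≤ μ.degree ∧
      (x.2.degree = μ.degree → multiIndexWeight x.2 ≤ multiIndexWeight μ) := by
  classical
  obtain ⟨x, hx, hmax⟩ := Finset.exists_max_image
    (a.support.filter fun x => jetOrder (pri x.1) = q)
    (fun x => toLex (x.2.degree, multiIndexWeight x.2))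
    (by obtain ⟨x, hx, hxq⟩ := h; exact ⟨x, Finset.mem_filter.mpr ⟨hx, hxq⟩⟩)
  rw [Finset.mem_filter] at hx
  refine ⟨x.1, x.2, hx.1, hx.2, fun y hy hyq => ?_⟩
  have := hmax y (Finset.mem_filter.mpr ⟨hy, hyq⟩)
  rw [Prod.Lex.toLex_le_toLex] at this
  dsimp only at this
  omega

/-- The nonmultiplicative prolongations of an involutive system: `d_i Ψ_τ` is a linear combination
of multiplicative prolongations with respect to derivations whose index is at most the class
of `Ψ_τ`. -/
theorem X_smul_mem_span_multProlong {Ψ : ι → Fin m → DiffOp k n} {pri : ι → Jet m n}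
    (hΨ : IsSolvedForm q Ψ pri) {τ : ι} {i : Fin n} {b : ℕ}
    (hb : jetOrder (pri τ) = q → ∃ j ∈ (pri τ).2.support, (j : ℕ) < b ∧ j < i)
    (hmem : (MvPolynomial.X i : DiffOp k n) • Ψ τ ∈
        Submodule.span k (Set.range Ψ ∪
          {P | ∃ (σ : ι) (j : Fin n), IsMultiplicative q (pri σ) j ∧
            P = (MvPolynomial.X j : DiffOp k n) • Ψ σ})) :
    (MvPolynomial.X i : DiffOp k n) • Ψ τ ∈
      Submodule.span k (prolong Ψ '' multProlong q pri b) := by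
  have hsub : Set.range Ψ ∪ {P | ∃ (σ : ι) (j : Fin n), IsMultiplicative q (pri σ) j ∧
      P = (MvPolynomial.X j : DiffOp k n) • Ψ σ} ⊆
      prolong Ψ '' (multProlong q pri n ∩ {x | x.2.degree ≤ 1}) := by
    rintro P (⟨σ, rfl⟩ | ⟨σ, j, hj, rfl⟩)
    · exact ⟨(σ, 0), ⟨by simp [multProlong], by simp⟩, by simp [prolong]⟩
    · refine ⟨(σ, Finsupp.single j 1), ⟨?_, by simp⟩, by simp [prolong, MvPolynomial.X]⟩
      intro l hl
      obtain rfl : j = l := by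
        simpa using Finsupp.support_single_subset hl |> Finset.mem_singleton.mp |> Eq.symm
      exact ⟨j.2, hj⟩
  obtain ⟨a, ha, hax⟩ := (Finsupp.mem_span_image_iff_linearCombination k).mp
    (Submodule.span_mono hsub hmem)
  have ha1 : a ∈ Finsupp.supported k k (multProlong q pri n) :=
    Finsupp.supported_mono Set.inter_subset_left ha
  rw [← hax]
  refine (Finsupp.mem_span_image_iff_linearCombination k).mpr ⟨a, ?_, rfl⟩
  by_cases hex : ∃ x ∈ a.support, jetOrder (pri x.1) = q
  swap
  · intro x hx l hl
    exact absurd ⟨x, hx, ((ha1 hx) l hl).2.1⟩ hex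
  -- The term of greatest weight bounds the index of every derivation used, and its leading jet
  -- survives in `d_i Ψ_τ`, which ties that index to the class of `Ψ_τ`.
  obtain ⟨σ, μ, hσ, hσq, hmax⟩ := exists_max_of_mem_support hex
  have hlead := jetCoeff_linearCombination_of_max hΨ ha1 hσ hσq hmax
  rw [hax] at hlead
  have hne : jetCoeff ((MvPolynomial.X i : DiffOp k n) • Ψ τ) ((pri σ).1, (pri σ).2 + μ) ≠ 0 := by
    rw [hlead]; exact Finsupp.mem_support_iff.mp hσ
  obtain ⟨ν, hν, hνc⟩ := exists_of_jetCoeff_monomial_smul_ne_zero hne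
  dsimp only at hν hνc
  have hμ1 : μ.degree ≤ 1 := (ha hσ).2
  intro x hx l hl
  have hxq := ((ha1 hx) l hl).2
  refine ⟨?_, hxq⟩
  have hx1 : x.2.degree ≤ 1 := (ha hx).2
  have hxl := eq_single_of_mem_support hx1 hl
  have hm := hmax x hx hxq.1
  rw [hxl, Finsupp.degree_single] at hm
  have hμd : μ.degree = 1 := by omega
  obtain ⟨s, hs⟩ : ∃ s, μ = Finsupp.single s 1 := by
    obtain ⟨s, hs⟩ : μ.support.Nonempty := by
      rw [Finsupp.support_nonempty_iff]
      rintro rfl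
      simp at hμd
    exact ⟨s, eq_single_of_mem_support hμ1 hs⟩
  have hls : (l : ℕ) ≤ s := by
    have := hm.2 hμd.symm
    rw [hs] at this
    simpa [multiIndexWeight, Finsupp.single_apply] using this
  have hdeg := congrArg Finsupp.degree hν
  simp only [map_add, Finsupp.degree_single, hμd] at hdeg
  have hσdeg : (pri σ).2.degree = q := hσq
  have hνord := hΨ.order_max τ _ hνc
  have hτq := hΨ.order_le τ
  change ν.degree ≤ _ at hνord
  obtain ⟨j, hj, hjb, hji⟩ := hb (by omega)
  have hcl := hΨ.class_max τ _ hνc (by change ν.degree = _; omega)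
  obtain ⟨t, ht, htj⟩ : ∃ t ∈ ν.support, t ≤ j := by
    have h1 : ν.support.min ≤ (j : WithTop (Fin n)) := hcl.trans (Finset.min_le hj)
    obtain ⟨t, ht⟩ := WithTop.ne_top_iff_exists.mp (ne_top_of_le_ne_top WithTop.coe_ne_top h1)
    exact ⟨t, Finset.mem_of_min ht.symm, by rw [← ht] at h1; exact WithTop.coe_le_coe.mp h1⟩
  -- `d_s` is multiplicative for `Ψ_σ`, so `s` is the least index of the leading jet, and `t` occurs
  -- in that jet.
  have hst : s ≤ t := by
    have hmem : t ∈ ((pri σ).2 + μ).support := by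
      rw [hν]
      simp only [Finsupp.mem_support_iff, Finsupp.add_apply] at ht ⊢
      omega
    have hmul := (isMultiplicative_iff.mp ((ha1 hσ) s (by simp [hs])).2).2
    by_cases h : s = t
    · exact h.le
    · refine hmul t ?_
      simpa [hs, Finsupp.single_apply, h] using hmem
  have h1 := Fin.le_def.mp hst
  have h2 := Fin.le_def.mp htj
  omega

end Jets

/-! ### Normal forms modulo an involutive system, and finiteness -/

section Involutive

variable {k : Type*} [Field k] {m n q : ℕ} {ι : Type}

theorem mem_span_of_forall_jetVec_mem {R : Type*} [CommRing R] {M : Type*} [AddCommGroup M]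
    [Module R M] [Module k M] [Algebra k R] [IsScalarTower k R M] (N : Submodule R M)
    (f : (Fin m → DiffOp k n) →ₗ[k] M) {P : Fin m → DiffOp k n}
    (h : ∀ J, jetCoeff P J ≠ 0 → f (jetVec k J) ∈ N) : f P ∈ N := by
  have hP : P = ∑ l, ∑ μ ∈ (P l).support, (P l).coeff μ • jetVec k (l, μ) := by
    ext1 i
    rw [Finset.sum_apply, Finset.sum_eq_single i]
    · conv_lhs => rw [(P i).as_sum]
      simp [jetVec, MvPolynomial.smul_monomial]
    · intro l _ hl
      simp [jetVec, hl.symm]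
    · simp
  rw [hP, map_sum]
  refine N.sum_mem fun l _ => ?_
  rw [map_sum]
  refine N.sum_mem fun μ hμ => ?_
  rw [map_smul]
  exact N.smul_of_tower_mem _ (h (l, μ) (MvPolynomial.mem_support_iff.mp hμ))

theorem monomial_smul_mem {W : Submodule k (Fin m → DiffOp k n)} {s : Set (Fin n)}
    (hW : ∀ i ∈ s, ∀ w ∈ W, (MvPolynomial.X i : DiffOp k n) • w ∈ W) (μ : Fin n →₀ ℕ)
    (hμ : ∀ i ∈ μ.support, i ∈ s) {w : Fin m → DiffOp k n} (hw : w ∈ W) :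
    MvPolynomial.monomial μ (1 : k) • w ∈ W := by
  induction μ using Finsupp.induction_linear generalizing w with
  | zero => simpa using hw
  | add μ ν hμ' hν' =>
    rw [← one_mul (1 : k), ← MvPolynomial.monomial_mul, mul_smul]
    have hadd : ∀ i, i ∈ μ.support ∨ i ∈ ν.support → i ∈ s := fun i hi => hμ i (by
      simp only [Finsupp.mem_support_iff, Finsupp.add_apply] at hi ⊢
      omega)
    exact hμ' (fun i hi => hadd i (Or.inl hi)) (hν' (fun i hi => hadd i (Or.inr hi)) hw)
  | single i a =>
    induction a with
    | zero => simpa using hw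
    | succ a ih =>
      have hi : i ∈ s := hμ i (by simp)
      rw [← MvPolynomial.X_pow_eq_monomial] at ih ⊢
      rw [pow_succ', mul_smul]
      exact hW i hi _ (ih fun j hj => by
        rwa [Finset.mem_singleton.mp (Finsupp.support_single_subset hj)])

/-- The span of the multiplicative prolongations with respect to the first `c` derivations is
stable under these derivations. -/
theorem X_smul_mem_span_multProlong_of_mem {Ψ : ι → Fin m → DiffOp k n} {pri : ι → Jet m n}
    (hΨ : IsSolvedForm q Ψ pri)
    (hinv : ∀ (τ : ι) (i : Fin n), ¬ IsMultiplicative q (pri τ) i →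
      (MvPolynomial.X i : DiffOp k n) • Ψ τ ∈
        Submodule.span k (Set.range Ψ ∪
          {P | ∃ (σ : ι) (j : Fin n), IsMultiplicative q (pri σ) j ∧
            P = (MvPolynomial.X j : DiffOp k n) • Ψ σ}))
    (c : ℕ) (i : Fin n) (hic : (i : ℕ) < c) {w : Fin m → DiffOp k n}
    (hw : w ∈ Submodule.span k (prolong Ψ '' multProlong q pri c)) :
    (MvPolynomial.X i : DiffOp k n) • w ∈
      Submodule.span k (prolong Ψ '' multProlong q pri c) := by
  -- A nonmultiplicative `d_i` turns `Ψ_τ` into an element of the span for a smaller bound `b + 1 ≤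
  -- i < c`. The remaining `d_μ` uses only indices at most `b`, so the induction hypothesis applies.
  induction c using Nat.strong_induction_on generalizing i w with
  | _ c ih =>
  induction hw using Submodule.span_induction with
  | zero => rw [smul_zero]; exact zero_mem _
  | add x y _ _ hx hy => rw [smul_add]; exact add_mem hx hy
  | smul a x _ hx => rw [smul_comm]; exact Submodule.smul_mem _ a hx
  | mem x hx =>
    obtain ⟨⟨τ, μ⟩, hmem, rfl⟩ := hx
    by_cases hmul : IsMultiplicative q (pri τ) i
    · refine Submodule.subset_span ⟨(τ, μ + Finsupp.single i 1), fun j hj => ?_, ?_⟩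
      · by_cases hji : j = i
        · subst hji; exact ⟨hic, hmul⟩
        · refine hmem j ?_
          simpa [Finsupp.single_apply, Ne.symm hji] using hj
      · simp only [prolong, MvPolynomial.X, smul_smul, MvPolynomial.monomial_mul, one_mul]
        rw [add_comm]
    · by_cases hq : jetOrder (pri τ) = q
      · obtain ⟨b, hb, hbi⟩ : ∃ b ∈ (pri τ).2.support, b < i := by
          by_contra! hcon
          exact hmul (isMultiplicative_iff.mpr ⟨hq, hcon⟩)
        have hbi' := Fin.lt_def.mp hbi
        have hX := X_smul_mem_span_multProlong (b := (b : ℕ) + 1) hΨ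
          (fun _ => ⟨b, hb, Nat.lt_succ_self _, hbi⟩) (hinv τ i hmul)
        have := monomial_smul_mem (s := {j | (j : ℕ) < b + 1})
          (fun j hj w hw => ih (b + 1) (by omega) j hj hw) μ (fun j hj => by
            have := Fin.le_def.mp ((isMultiplicative_iff.mp (hmem j hj).2).2 b hb)
            exact Nat.lt_succ_of_le this) hX
        rw [smul_comm] at this
        exact Submodule.span_mono (Set.image_mono (multProlong_mono (by omega))) this
      · have hμ : μ = 0 := by
          rw [← Finsupp.support_eq_empty, Finset.eq_empty_iff_forall_notMem]
          exact fun j hj => hq (hmem j hj).2.1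
        -- The bound `0` allows no derivation at all: a prolongation of an equation of lower order
        -- is a combination of the equations themselves.
        have hX := X_smul_mem_span_multProlong (b := 0) hΨ (fun h => absurd h hq) (hinv τ i hmul)
        subst hμ
        rw [prolong]
        simp only [MvPolynomial.monomial_zero', map_one, one_smul]
        exact Submodule.span_mono (Set.image_mono (multProlong_mono (Nat.zero_le c))) hX

/-- The multiplicative prolongations of an involutive system span the differential submodule
generated by it. -/
theorem mem_span_multProlong_of_mem_span {Ψ : ι → Fin m → DiffOp k n} {pri : ι → Jet m n}
    (hΨ : IsSolvedForm q Ψ pri)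
    (hinv : ∀ (τ : ι) (i : Fin n), ¬ IsMultiplicative q (pri τ) i →
      (MvPolynomial.X i : DiffOp k n) • Ψ τ ∈
        Submodule.span k (Set.range Ψ ∪
          {P | ∃ (σ : ι) (j : Fin n), IsMultiplicative q (pri σ) j ∧
            P = (MvPolynomial.X j : DiffOp k n) • Ψ σ}))
    {w : Fin m → DiffOp k n} (hw : w ∈ Submodule.span (DiffOp k n) (Set.range Ψ)) :
    w ∈ Submodule.span k (prolong Ψ '' multProlong q pri n) := by
  induction hw using Submodule.span_induction with
  | zero => exact zero_mem _
  | add x y _ _ hx hy => exact add_mem hx hy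
  | mem x hx =>
    obtain ⟨τ, rfl⟩ := hx
    exact Submodule.subset_span ⟨(τ, 0), by simp [multProlong], by simp [prolong]⟩
  | smul f x _ hx =>
    induction f using MvPolynomial.induction_on generalizing x with
    | C a =>
      rw [← MvPolynomial.algebraMap_eq, algebraMap_smul]
      exact Submodule.smul_mem _ a hx
    | add f g hf hg => rw [add_smul]; exact add_mem (hf x ‹_› hx) (hg x ‹_› hx)
    | mul_X f i hf =>
      rw [mul_smul]
      exact hf _ (Submodule.smul_mem _ _ ‹_›)
        (X_smul_mem_span_multProlong_of_mem hΨ hinv n i i.2 hx)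

/-- A parametric jet `J` of order `q` of an involutive system has no nonzero annihilator in the
variables whose index is at most the class of `J`. -/
theorem eq_zero_of_smul_jetVec_mem {Ψ : ι → Fin m → DiffOp k n} {pri : ι → Jet m n}
    (hΨ : IsSolvedForm q Ψ pri) {J : Jet m n} (hJq : jetOrder J = q) (hJ : ∀ τ, pri τ ≠ J)
    {f : DiffOp k n} (hf : ∀ i ∈ f.vars, ∀ j ∈ J.2.support, i ≤ j)
    (hmem : f • jetVec k J ∈ Submodule.span k (prolong Ψ '' multProlong q pri n)) : f = 0 := by
  obtain ⟨a, ha, hax⟩ := (Finsupp.mem_span_image_iff_linearCombination k).mp hmem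
  have hcoeff : ∀ μ, jetCoeff (f • jetVec k J) (J.1, J.2 + μ) = f.coeff μ := by
    intro μ
    simp [jetCoeff, jetVec, add_comm J.2]
  have hsupp : ∀ K, jetCoeff (f • jetVec k J) K ≠ 0 → ∃ μ ∈ f.support, K = (J.1, J.2 + μ) := by
    rintro ⟨l, ν⟩ hK
    by_cases hl : l = J.1
    · subst hl
      simp only [jetCoeff, jetVec, Pi.smul_apply, Pi.single_eq_same, smul_eq_mul,
        MvPolynomial.coeff_mul_monomial'] at hK
      split_ifs at hK with hle
      · refine ⟨ν - J.2, by simpa using hK, ?_⟩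
        rw [add_tsub_cancel_of_le hle]
      · exact absurd rfl hK
    · simp [jetCoeff, jetVec, hl] at hK
  by_cases hex : ∃ x ∈ a.support, jetOrder (pri x.1) = q
  · obtain ⟨τ, μ, hτ, hτq, hmax⟩ := exists_max_of_mem_support hex
    have hlead := jetCoeff_linearCombination_of_max hΨ ha hτ hτq hmax
    rw [hax] at hlead
    obtain ⟨ν, hν, heq⟩ := hsupp _ (by rw [hlead]; exact Finsupp.mem_support_iff.mp hτ)
    obtain ⟨h1, h2⟩ := Prod.ext_iff.mp heq
    dsimp only at h1 h2
    have hdeg : μ.degree = ν.degree := by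
      have := congrArg Finsupp.degree h2
      rw [map_add, map_add] at this
      have e1 : (pri τ).2.degree = q := hτq
      have e2 : J.2.degree = q := hJq
      omega
    have hνvars : ∀ i ∈ ν.support, i ∈ f.vars :=
      fun i hi => (MvPolynomial.mem_vars_iff_mem_support i).mpr ⟨ν, hν, hi⟩
    -- The leading jet is decomposed both as `pri τ + μ` and as `J + ν`; each decomposition has
    -- least weight, so they coincide and `J` would be principal.
    have hw := multiIndexWeight_le_of_add_eq h2 hdeg
      fun i hi => (isMultiplicative_iff.mp ((ha hτ) i hi).2).2
    have hw' := multiIndexWeight_le_of_add_eq h2.symm hdeg.symm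
      fun i hi => hf i (hνvars i hi)
    obtain rfl := hw.2 (le_antisymm hw.1 hw'.1)
    exact absurd (Prod.ext h1 (add_right_cancel h2)) (hJ τ)
  -- Only unprolonged equations of order less than `q` remain, whereas all jets of `f • J` have
  -- order at least `q`.
  · ext μ
    rw [← hcoeff, ← hax, MvPolynomial.coeff_zero, ← jetCoeffLin_apply,
      Finsupp.linearCombination_apply, Finsupp.sum, map_sum]
    refine Finset.sum_eq_zero fun x hx => ?_
    have hxq : jetOrder (pri x.1) ≠ q := fun h => hex ⟨x, hx, h⟩
    have hμ0 : x.2 = 0 := by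
      rw [← Finsupp.support_eq_empty, Finset.eq_empty_iff_forall_notMem]
      exact fun j hj => hxq ((ha hx) j hj).2.1
    rw [map_smul, jetCoeffLin_apply, prolong, hμ0]
    by_contra hne
    have hne' := right_ne_zero_of_mul hne
    simp only [MvPolynomial.monomial_zero', map_one, one_smul] at hne'
    have h1 := hΨ.order_max x.1 _ hne'
    have h2 := hΨ.order_le x.1
    have e2 : J.2.degree = q := hJq
    simp only [jetOrder, map_add] at h1 h2 hxq
    omega

/-- If all jets of order `q` whose class is at least `s` are principal, the differential module
is finite over the polynomials in the first `s` variables. -/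
theorem finite_firstVars_quotient {Ψ : ι → Fin m → DiffOp k n} {pri : ι → Jet m n}
    (hΨ : IsSolvedForm q Ψ pri) {s : ℕ} {S : Submodule (DiffOp k n) (Fin m → DiffOp k n)}
    (hS : ∀ τ, Ψ τ ∈ S)
    (hpri : ∀ J : Jet m n, jetOrder J = q → (∀ i ∈ J.2.support, s ≤ (i : ℕ)) → ∃ τ, pri τ = J) :
    Module.Finite (firstVars k n s) ((Fin m → DiffOp k n) ⧸ S) := by
  have hfin : {J : Jet m n | jetOrder J ≤ q}.Finite := by
    refine (Set.finite_univ.prod (Finsupp.finite_of_degree_le (σ := Fin n) q)).subset ?_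
    exact fun J hJ => ⟨Set.mem_univ _, hJ⟩
  let N : Submodule (firstVars k n s) ((Fin m → DiffOp k n) ⧸ S) :=
    Submodule.span _ ((fun J => S.mkQ (jetVec k J)) '' {J : Jet m n | jetOrder J ≤ q})
  have hmk : ∀ P : Fin m → DiffOp k n, (∀ J, jetCoeff P J ≠ 0 → S.mkQ (jetVec k J) ∈ N) →
      S.mkQ P ∈ N := fun P h => mem_span_of_forall_jetVec_mem N (S.mkQ.restrictScalars k) h
  have hlow : ∀ J : Jet m n, jetOrder J ≤ q → S.mkQ (jetVec k J) ∈ N :=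
    fun J hJ => Submodule.subset_span ⟨J, hJ, rfl⟩
  have hall : ∀ d : ℕ, ∀ J : Jet m n, jetOrder J = d → S.mkQ (jetVec k J) ∈ N := by
    intro d
    induction d using Nat.strong_induction_on with
    | _ d ih =>
    -- A jet involving one of the first `s` variables is that variable, a scalar here, times a jet
    -- of lower order.
    have hsmall : ∀ J : Jet m n, jetOrder J = d → (∃ i ∈ J.2.support, (i : ℕ) < s) →
        S.mkQ (jetVec k J) ∈ N := by
      rintro ⟨l, μ⟩ hJ ⟨i, hi, his⟩
      obtain ⟨ν, rfl⟩ := exists_add_of_le (a := Finsupp.single i 1) (b := μ)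
        (by simpa [Nat.one_le_iff_ne_zero] using hi)
      simp only [jetOrder, map_add, Finsupp.degree_single] at hJ
      have := ih ν.degree (by omega) (l, ν) rfl
      have hX : (MvPolynomial.X i : DiffOp k n) ∈ firstVars k n s :=
        MvPolynomial.X_mem_supported.mpr his
      have h2 := N.smul_mem ⟨_, hX⟩ this
      have h3 : jetVec k (l, Finsupp.single i 1 + ν) =
          (MvPolynomial.X i : DiffOp k n) • jetVec k (l, ν) := by
        rw [MvPolynomial.X, monomial_smul_jetVec, add_comm]
      rw [h3, map_smul]
      exact h2
    intro J hJ
    by_cases hdq : d ≤ q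
    · exact hlow J (hJ.trans_le hdq)
    by_cases hs : ∃ i ∈ J.2.support, (i : ℕ) < s
    · exact hsmall J hJ hs
    push Not at hs
    obtain ⟨l, μ⟩ := J
    obtain ⟨ν, hνμ, hν⟩ := Finsupp.exists_le_degree_eq μ q (by
      change μ.degree = d at hJ
      omega)
    obtain ⟨ρ, rfl⟩ := exists_add_of_le hνμ
    obtain ⟨τ, hτ⟩ := hpri (l, ν) hν fun i hi => hs i (by
      simp only [Finsupp.mem_support_iff, Finsupp.add_apply] at hi ⊢
      omega)
    -- Modulo `S` the jet equals minus the prolonged tail of `Ψ τ`. The tail jets of order `q` are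
    -- not principal, hence involve a variable of index below `s`.
    have hdec : jetVec k (l, ν + ρ) = MvPolynomial.monomial ρ (1 : k) • Ψ τ -
        MvPolynomial.monomial ρ (1 : k) • (Ψ τ - jetVec k (l, ν)) := by
      rw [smul_sub, monomial_smul_jetVec, sub_sub_cancel]
    have hzero : S.mkQ (MvPolynomial.monomial ρ (1 : k) • Ψ τ) = 0 :=
      (Submodule.Quotient.mk_eq_zero S).mpr (S.smul_mem _ (hS τ))
    rw [hdec, map_sub, hzero, zero_sub]
    refine N.neg_mem (hmk _ fun K hK => ?_)
    obtain ⟨κ, hκ, hcoeff⟩ := exists_of_jetCoeff_monomial_smul_ne_zero hK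
    rw [← jetCoeffLin_apply, map_sub, jetCoeffLin_apply, jetCoeffLin_apply, ← hτ,
      jetCoeff_jetVec] at hcoeff
    have hne : (K.1, κ) ≠ pri τ := by
      intro h
      rw [h, hΨ.coeff_self] at hcoeff
      simp at hcoeff
    rw [if_neg hne, sub_zero] at hcoeff
    have hord := hΨ.order_max τ _ hcoeff
    have hτq : jetOrder (pri τ) = q := by rw [hτ]; exact hν
    have hKdeg : jetOrder K = κ.degree + ρ.degree := by rw [jetOrder, hκ, map_add]
    have hJdeg : q + ρ.degree = d := by rw [← hJ, jetOrder, map_add, hν]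
    change κ.degree ≤ _ at hord
    rcases hord.lt_or_eq with hlt | heq
    · exact ih _ (by omega) K rfl
    · refine hsmall K (by omega) ?_
      by_contra! hge
      obtain ⟨σ, hσ⟩ := hpri (K.1, κ) (heq.trans hτq) fun i hi => hge i (by
        rw [hκ]
        simp only [Finsupp.mem_support_iff, Finsupp.add_apply] at hi ⊢
        omega)
      rw [← hσ] at hcoeff hne
      exact hcoeff (hΨ.coeff_other τ σ fun h => hne (by rw [h]))
  refine ⟨Submodule.fg_def.mpr ⟨(fun J => S.mkQ (jetVec k J)) '' {J : Jet m n | jetOrder J ≤ q},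
    hfin.image _, eq_top_iff.mpr fun x _ => ?_⟩⟩
  obtain ⟨P, rfl⟩ := S.mkQ_surjective x
  exact hmk P fun J _ => hall _ J rfl

theorem finite_firstVars_of_le {M : Type*} [AddCommGroup M] [Module (DiffOp k n) M]
    [Module.Finite (DiffOp k n) M] {s : ℕ} (hs : n ≤ s) : Module.Finite (firstVars k n s) M := by
  have htop : firstVars k n s = ⊤ := by
    rw [firstVars, ← MvPolynomial.supported_univ]
    congr 1
    ext i
    simpa using i.2.trans_le hs
  have : Module.Finite (firstVars k n s) (DiffOp k n) :=
    Module.Finite.of_surjective (Algebra.linearMap (firstVars k n s) (DiffOp k n))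
      fun f => ⟨⟨f, htop ▸ Algebra.mem_top⟩, rfl⟩
  exact Module.Finite.trans (DiffOp k n) M

end Involutive

theorem theorem3p8 {k : Type*} [Field k] [CharZero k] (n m q r : ℕ)
    (Φ : Set (Fin m → DiffOp k n)) (hΦ : IsInvolutive q Φ)
    (hr : moduleCodim k n (DiffModule Φ) = r) :
    IsGreatest {N : Submodule (DiffOp k n) (DiffModule Φ) | (r : ℕ∞) < moduleCodim k n N}
        (torsionSub k n r (DiffModule Φ)) ∧
      Function.Exact (torsionSub k n r (DiffModule Φ)).subtype
        (partialLoc k n (n - r) (DiffModule Φ)) := by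
  have hfin : Module.Finite (firstVars k n (n - r)) (DiffModule Φ) := by
    rcases Nat.eq_zero_or_pos r with rfl | hr0
    -- For `r = 0` the subring is all of `D`; the argument below needs `r - 1 < r`.
    · exact finite_firstVars_of_le le_rfl
    obtain ⟨p, Ψ, pri, hΨ, hspan, hinv⟩ := hΦ
    have hspanD : Submodule.span (DiffOp k n) Φ = Submodule.span (DiffOp k n) (Set.range Ψ) := by
      rw [← Submodule.span_span_of_tower k (DiffOp k n) Φ, ← hspan,
        Submodule.span_span_of_tower]
    refine finite_firstVars_quotient hΨ (s := n - r)
      (fun τ => by rw [hspanD]; exact Submodule.subset_span ⟨τ, rfl⟩) fun J hJ hJs => ?_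
    by_contra! hcon
    -- Using `r - 1` allows one more variable: `f` has zero-based indices at most `n - r`, and those
    -- of `J` are at least `n - r`.
    obtain ⟨f, hf, f0, hann⟩ := exists_mem_firstVars_annihilator (k := k) (n := n) (r := r - 1)
      (N := DiffModule Φ) (by rw [hr]; exact_mod_cast (by omega))
    refine f0 (eq_zero_of_smul_jetVec_mem hΨ hJ hcon (f := f) (fun i hi j hj => ?_) ?_)
    · have h1 : (i : ℕ) < n - (r - 1) := (MvPolynomial.mem_supported.mp hf) hi
      have h2 := hJs j hj
      rw [Fin.le_def]
      omega
    · refine mem_span_multProlong_of_mem_span hΨ hinv ?_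
      rw [← hspanD]
      exact (Submodule.Quotient.mk_eq_zero _).mp
        (Module.mem_annihilator.mp hann (Submodule.Quotient.mk (jetVec k J)))
  have hgr := isGreatest_firstVarsTorsion (k := k) (n := n) (r := r) (M := DiffModule Φ)
  have htor : torsionSub k n r (DiffModule Φ) = firstVarsTorsion k n (n - r) (DiffModule Φ) :=
    hgr.isLUB.sSup_eq
  rw [htor]
  refine ⟨hgr, fun x => ?_⟩
  rw [partialLoc_eq_zero_iff]
  constructor
  · intro hx
    exact ⟨⟨x, hx⟩, rfl⟩
  · rintro ⟨x, rfl⟩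
    exact x.2
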